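/- **Lemma (Stochastic equicontinuity of the XBART split criterion).** *Data.* Let $f:[0,1]^p\to\mathbb R$ be bounded and continuous. Let $(\mathrm x_i,y_i)_{i\ge 1}$ be i.i.d. pairs with $\mathrm x_i$ uniform on $[0,1]^p$, $\mathbb E[y_i^2]<\infty$ and $\mathbb E[y_i\mid \mathrm x_i]=f(\mathrm x_i)$. Let $\sigma,\tau>0$ be fixed. *Cuts and cells.* A cut is a pair $c=(c^{(1)},c^{(2)})\in\{1,\dots,p\}\times[0,1]$; a point $\mathrm z$ goes left at $c$ if $\mathrm z^{(c^{(1)})}\le c^{(2)}$ and right otherwise. For a sequence of $k$ cuts $\mathbf c_k=(c_1,\dots,c_k)$ write $\mathbf c_{k-1}=(c_1,\dots,c_{k-1})$, and let $\mathcal A(\mathrm x,\mathbf c_{k-1})$ be the cell of $[0,1]^p$ containing $\mathrm x$, i.e. the set of points that go the same way as $\mathrm x$ at each of $c_1,\dots,c_{k-1}$ (for $k=1$ it is $[0,1]^p$). Put $$\|\mathbf c_k-\mathbf c_k'\|_\infty=\max_{1\le j\le k}\max\big(|c_j^{(1)}-c_j'^{(1)}|,\ |c_j^{(2)}-c_j'^{(2)}|\big),$$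 and let $\bar{\mathbb A}_k^\xi(\mathrm x)$ be the set of all $\mathbf c_k$ such that $\mathcal A(\mathrm x,\mathbf c_{k-1})$ contains a (closed, axis-parallel) hypercube with edge length $\xi$. *Criterion.* Let $\mathcal A_L$ and $\mathcal A_R$ be the parts of $\mathcal A(\mathrm x,\mathbf c_{k-1})$ that go left and right at $c_k$. For $B\in\{L,R\}$ let $N_B$ be the number of $i\le n$ with $\mathrm x_i\in\mathcal A_B$, and $\bar y_B$ the mean of the corresponding $y_i$. Define $$L_{n,k}(\mathrm x,\mathbf c_k)=\sum_{B\in\{L,R\}}\frac{\tau N_B}{\sigma^2(\sigma^2+\tau N_B)}\,\frac1n\Big(\sum_{i\le n:\,\mathrm x_i\in\mathcal A_B}y_i^2-\sum_{i\le n:\,\mathrm x_i\in\mathcal A_B}(y_i-\bar y_B)^2\Big)+\frac{\gamma_{n}(\mathbf c_k)}{n},$$ where a summand with $N_B=0$ is $0$ and $\gamma_n(\mathbf c_k)$ is the Gumbel perturbation of the candidate cutpoint. Cut sequences are the same candidate if, at each of the $k$ steps, they cut on the same variable, send the same number of the $n$ observations $\mathrm x_1,\dots,\mathrm x_n$ to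 the left, and send $\mathrm x$ to the same side. To each $n$ and each possible such description (for each of the $k$ steps, a variable, a number and a side) there belongs one random variable with the Gumbel$(0,1)$ distribution, which has density $\exp[-t-\exp(-t)]$, and $\gamma_n(\mathbf c_k)$ is the variable belonging to the description of $\mathbf c_k$. The joint law of these variables, also with the data, is arbitrary: they may be independent, or all equal to one variable $\gamma_{\mathrm x}$. *Claim.* Fix $\mathrm x\in[0,1]^p$, $k\ge1$ and $\xi>0$. Then $L_{n,k}(\mathrm x,\cdot)$ is stochastically equicontinuous on $\bar{\mathbb A}_k^\xi(\mathrm x)$ along each path of $\mathrm x$: for all $\alpha,\rho>0$ there is $\delta>0$ such that the following limit exists and $$\lim_{n\to\infty}\mathbb P\Big[\sup\big|L_{n,k}(\mathrm x,\mathbf c_k)-L_{n,k}(\mathrm x,\mathbf c_k')\big|>\alpha\Big]\le\rho,$$ the supremum being over all $\mathbf c_k,\mathbf c_k'\in\bar{\mathbb A}_k^\xi(\mathrm x)$ with $\|\mathbf c_k-\mathbf c_k'\|_\infty\le\delta$ such that, for every $j<k$, $\mathrm x$ goes to the same side at $c_j$ as at $c_j'$. ($\mathbb P$ is outer probability if the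 event is not measurable.) -/

import Mathlib

open MeasureTheory ProbabilityTheory Filter Topology
open scoped ENNReal

noncomputable section

namespace XBART

/-- A cut `c = (c⁽¹⁾, c⁽²⁾)`: the variable that is cut on, and the value it is cut at. -/
abbrev Cut (p : ℕ) : Type := Fin p × ℝ

/-- The point `z` goes to the left child of the cut `c`, that is `z⁽ʲ⁾ ≤ t` where `c = (j, t)`. -/
def GoesLeft {p : ℕ} (c : Cut p) (z : Fin p → ℝ) : Prop := z c.1 ≤ c.2

/-- The sup distance between two sequences of `k` cuts, a cut being read as the pair of real
numbers (index of the variable, cut value). -/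
def cutDist {p k : ℕ} (c c' : Fin k → Cut p) : ℝ :=
  ⨆ l : Fin k,
    max |(((c l).1 : ℕ) : ℝ) - (((c' l).1 : ℕ) : ℝ)| |(c l).2 - (c' l).2|

/-- `A(x, c)`: the cell of `[0,1]^p` containing `x` in the tree built with the cut sequence `c`.
It consists of the points that go to the same side as `x` at every cut. -/
def node {p k : ℕ} (x : Fin p → ℝ) (c : Fin k → Cut p) : Set (Fin p → ℝ) :=
  {z | z ∈ Set.Icc 0 1 ∧ ∀ l, (GoesLeft (c l) z ↔ GoesLeft (c l) x)}

/-- The set `A` contains a closed axis-parallel hypercube with edge length `ξ`. -/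
def ContainsCube {p : ℕ} (ξ : ℝ) (A : Set (Fin p → ℝ)) : Prop :=
  ∃ a : Fin p → ℝ, Set.Icc a (fun j => a j + ξ) ⊆ A

/-- The set of sequences of `k + 1` cuts, with cut values in `[0,1]`, such that the cell of `x`
after the first `k` cuts contains a hypercube with edge length `ξ`. -/
def admissibleCuts {p : ℕ} (k : ℕ) (ξ : ℝ) (x : Fin p → ℝ) : Set (Fin (k + 1) → Cut p) :=
  {c | (∀ l, (c l).2 ∈ Set.Icc (0 : ℝ) 1) ∧ ContainsCube ξ (node x (Fin.init c))}

/-- At each of the first `k` cuts, those which create the cell that is to be split, `x` falls on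
the same side of `c` and of `c'`. The last cut is not constrained. -/
def SamePath {p k : ℕ} (x : Fin p → ℝ) (c c' : Fin (k + 1) → Cut p) : Prop :=
  ∀ l : Fin k, (GoesLeft (Fin.init c l) x ↔ GoesLeft (Fin.init c' l) x)

open Classical in
/-- The observations, among the first `n`, in the left child of the cell `A(x, (c₁, …, c_k))`
under the cut `c_{k+1}`. -/
def leftObs {p k : ℕ} (xs : ℕ → Fin p → ℝ) (n : ℕ) (x : Fin p → ℝ) (c : Fin (k + 1) → Cut p) :
    Finset ℕ :=
  {i ∈ Finset.range n | xs i ∈ node x (Fin.init c) ∧ GoesLeft (c (Fin.last k)) (xs i)}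

open Classical in
/-- The observations, among the first `n`, in the right child of the cell `A(x, (c₁, …, c_k))`
under the cut `c_{k+1}`. -/
def rightObs {p k : ℕ} (xs : ℕ → Fin p → ℝ) (n : ℕ) (x : Fin p → ℝ) (c : Fin (k + 1) → Cut p) :
    Finset ℕ :=
  {i ∈ Finset.range n | xs i ∈ node x (Fin.init c) ∧ ¬ GoesLeft (c (Fin.last k)) (xs i)}

/-- The mean of the responses over a set of observations. -/
def obsMean (ys : ℕ → ℝ) (S : Finset ℕ) : ℝ := (∑ i ∈ S, ys i) / (S.card : ℝ)

/-- The contribution of a child node with set of observations `S` to the split criterion: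
`τ N / (σ² (σ² + τ N)) · (1/n) · (∑ yᵢ² - ∑ (yᵢ - ȳ)²)` with `N = #S`. It is `0` when the child
is empty. -/
def childTerm (σ τ : ℝ) (ys : ℕ → ℝ) (n : ℕ) (S : Finset ℕ) : ℝ :=
  τ * (S.card : ℝ) / (σ ^ 2 * (σ ^ 2 + τ * (S.card : ℝ))) * (1 / (n : ℝ)) *
    (∑ i ∈ S, ys i ^ 2 - ∑ i ∈ S, (ys i - obsMean ys S) ^ 2)

/-- What a cut `c` looks like from the sample: the variable that is cut on, the number of the
first `n` observations that go left, and the side of the point `x`. Cut values with the same code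
are the same candidate cutpoint. -/
abbrev CutCode (p : ℕ) : Type := Fin p × ℕ × Prop

open Classical in
/-- The codes of a sequence of cuts. -/
def cutCode {p k : ℕ} (xs : ℕ → Fin p → ℝ) (n : ℕ) (x : Fin p → ℝ) (c : Fin k → Cut p) :
    Fin k → CutCode p :=
  fun l => ((c l).1, (Finset.card {i ∈ Finset.range n | GoesLeft (c l) (xs i)}),
    GoesLeft (c l) x)

/-- The empirical split criterion `L_{n,k+1}(x, c)` for the data `(xs i, ys i)`, `i < n`. The
values `g` are the perturbations of the candidate cutpoints. -/
def splitCriterion {p k : ℕ} (σ τ : ℝ) (xs : ℕ → Fin p → ℝ) (ys : ℕ → ℝ)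
    (g : (Fin (k + 1) → CutCode p) → ℝ) (n : ℕ) (x : Fin p → ℝ) (c : Fin (k + 1) → Cut p) : ℝ :=
  childTerm σ τ ys n (leftObs xs n x c) + childTerm σ τ ys n (rightObs xs n x c) +
    g (cutCode xs n x c) / (n : ℝ)

/-- The Gumbel(0,1) distribution, with density `exp (-(t + exp (-t)))`. -/
def gumbelMeasure : Measure ℝ :=
  volume.withDensity fun t => ENNReal.ofReal (Real.exp (-(t + Real.exp (-t))))

/-- The sup of `|L c - L c'|` over the pairs of admissible cut sequences at distance at most `δ`
along which `x` follows the same path. -/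
def criterionModulus {p k : ℕ} (ξ : ℝ) (x : Fin p → ℝ) (δ : ℝ)
    (L : (Fin (k + 1) → Cut p) → ℝ) : ℝ≥0∞ :=
  ⨆ (c ∈ admissibleCuts k ξ x) (c' ∈ admissibleCuts k ξ x)
    (_ : cutDist c c' ≤ δ) (_ : SamePath x c c'), ENNReal.ofReal |L c - L c'|

end XBART

end

/-! With `b = σ² / τ`, each child term equals `(∑ yᵢ)² / (b + N)` divided by `σ² n`. This functional
is stable in two ways, whatever the size of the child. Truncating the responses at `±M` changes it
by at most `∑ (yᵢ² - M²)⁺`; if responses are bounded by `M`, removing `d` observations changes it by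
at most `3 M² d` (`abs_ridge_sub_ridge_le`).

Two cut sequences within `δ = 1 / m < 1` cut on the same variables. Along a common path of `x`,
their children differ only by observations lying between corresponding cut values, and these lie in
two adjacent slabs of width `1 / m`. A supremum over uncountably many pairs is thus controlled by
finitely many slab counts (`criterionModulus_le`).

By the law of large numbers, slab proportions are eventually below `2 / m`, and the mean excess
`(yᵢ² - M²)⁺` is small once `M` is large. The perturbations need only a union bound: polynomially
many candidates against a Gumbel tail `2 exp (-G n)`. The bad event therefore has probability
tending to `0`. -/

noncomputable section

namespace XBART

/-! ### Stability of the ridge functional -/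

/-- The regularised sum of squares explained by the mean of the responses over `S`. -/
def ridge (b : ℝ) (ys : ℕ → ℝ) (S : Finset ℕ) : ℝ :=
  (∑ i ∈ S, ys i) ^ 2 / (b + S.card)

theorem childTerm_eq_ridge {σ τ : ℝ} (hσ : 0 < σ) (hτ : 0 < τ) (ys : ℕ → ℝ) (n : ℕ)
    (S : Finset ℕ) :
    childTerm σ τ ys n S = ridge (σ ^ 2 / τ) ys S / (σ ^ 2 * n) := by
  rcases S.eq_empty_or_nonempty with rfl | hS
  · simp [childTerm, ridge]
  have hN : (0 : ℝ) < S.card := by exact_mod_cast hS.card_pos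
  have hsum : ∑ i ∈ S, ys i ^ 2 - ∑ i ∈ S, (ys i - obsMean ys S) ^ 2
      = (∑ i ∈ S, ys i) ^ 2 / S.card := by
    rw [← Finset.sum_sub_distrib]
    have : ∀ i ∈ S, ys i ^ 2 - (ys i - obsMean ys S) ^ 2
        = 2 * obsMean ys S * ys i - obsMean ys S ^ 2 := fun i _ => by ring
    rw [Finset.sum_congr rfl this, Finset.sum_sub_distrib, ← Finset.mul_sum, Finset.sum_const,
      nsmul_eq_mul, obsMean]
    field_simp
    ring
  rw [childTerm, hsum, ridge]
  have h1 : σ ^ 2 + τ * S.card ≠ 0 := by positivity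
  have h2 : σ ^ 2 / τ + S.card ≠ 0 := by positivity
  rcases eq_or_ne (n : ℝ) 0 with hn | hn
  · simp [hn]
  field_simp

/-- Truncation of a real number to `[-M, M]`. -/
def trunc (M y : ℝ) : ℝ := max (-M) (min y M)

theorem abs_trunc_le {M : ℝ} (hM : 0 ≤ M) (y : ℝ) : |trunc M y| ≤ M := by
  rw [abs_le, trunc]
  exact ⟨le_max_left _ _, max_le (by linarith) (min_le_right _ _)⟩

/-- Beyond `±M` the remainder has modulus `|y| - M`, so completing the square gives `y² - M²`;
otherwise both sides vanish. -/
theorem trunc_remainder {M : ℝ} (hM : 0 ≤ M) (y : ℝ) :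
    2 * M * |y - trunc M y| + (y - trunc M y) ^ 2 = max (y ^ 2 - M ^ 2) 0 := by
  rw [trunc]
  rcases le_total y M with h1 | h1
  · rw [min_eq_left h1]
    rcases le_total (-M) y with h2 | h2
    · rw [max_eq_right h2, max_eq_right (by nlinarith)]
      simp
    · rw [max_eq_left h2, max_eq_left (by nlinarith), abs_of_nonpos (by linarith)]
      ring
  · rw [min_eq_right h1, max_eq_right (by linarith), max_eq_left (by nlinarith),
      abs_of_nonneg (by linarith)]
    ring

theorem abs_sum_le_card_mul {M : ℝ} {h : ℕ → ℝ} (hh : ∀ i, |h i| ≤ M) (S : Finset ℕ) :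
    |∑ i ∈ S, h i| ≤ S.card * M :=
  (Finset.abs_sum_le_sum_abs _ _).trans <| by
    simpa using Finset.sum_le_card_nsmul S (fun i => |h i|) M fun i _ => hh i

/-- The truncated sum is at most `N M`, and Cauchy–Schwarz bounds the squared sum of remainders by
`N` times their sum of squares. The denominator absorbs the factor `N`, leaving exactly the sum in
`trunc_remainder`. -/
theorem abs_ridge_sub_ridge_trunc_le {b M : ℝ} (hb : 0 < b) (hM : 0 ≤ M) (ys : ℕ → ℝ)
    (S : Finset ℕ) :
    |ridge b ys S - ridge b (fun i => trunc M (ys i)) S|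
      ≤ ∑ i ∈ S, max (ys i ^ 2 - M ^ 2) 0 := by
  have hb' : 0 < b + S.card := by positivity
  have hH := abs_sum_le_card_mul (fun i => abs_trunc_le hM (ys i)) S
  set H := ∑ i ∈ S, trunc M (ys i) with hHdef
  set r : ℕ → ℝ := fun i => ys i - trunc M (ys i) with hr
  have hsum : ∑ i ∈ S, ys i = H + ∑ i ∈ S, r i := by
    rw [hHdef, ← Finset.sum_add_distrib]
    exact Finset.sum_congr rfl fun i _ => by simp [hr]
  have hR : |∑ i ∈ S, r i| ≤ ∑ i ∈ S, |r i| := Finset.abs_sum_le_sum_abs _ _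
  have hR2 : (∑ i ∈ S, r i) ^ 2 ≤ S.card * ∑ i ∈ S, r i ^ 2 := sq_sum_le_card_mul_sum_sq
  have hE : ∑ i ∈ S, max (ys i ^ 2 - M ^ 2) 0
      = 2 * M * ∑ i ∈ S, |r i| + ∑ i ∈ S, r i ^ 2 := by
    rw [Finset.mul_sum, ← Finset.sum_add_distrib]
    exact Finset.sum_congr rfl fun i _ => (trunc_remainder hM (ys i)).symm
  have hQ : 0 ≤ ∑ i ∈ S, r i ^ 2 := Finset.sum_nonneg fun i _ => sq_nonneg _
  have hA : 0 ≤ ∑ i ∈ S, |r i| := Finset.sum_nonneg fun i _ => abs_nonneg _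
  have hdiff : ridge b ys S - ridge b (fun i => trunc M (ys i)) S
      = (2 * H * ∑ i ∈ S, r i + (∑ i ∈ S, r i) ^ 2) / (b + S.card) := by
    rw [ridge, ridge, hsum, ← hHdef]
    ring
  rw [hdiff, hE, abs_div, abs_of_pos hb', div_le_iff₀ hb']
  have h1 : |H * ∑ i ∈ S, r i| ≤ S.card * M * ∑ i ∈ S, |r i| := by
    rw [abs_mul]
    exact mul_le_mul hH hR (abs_nonneg _) (by positivity)
  calc |2 * H * ∑ i ∈ S, r i + (∑ i ∈ S, r i) ^ 2|
      ≤ |2 * H * ∑ i ∈ S, r i| + |(∑ i ∈ S, r i) ^ 2| := abs_add_le _ _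
    _ = 2 * |H * ∑ i ∈ S, r i| + (∑ i ∈ S, r i) ^ 2 := by
        rw [mul_assoc, abs_mul, abs_two, abs_of_nonneg (sq_nonneg (∑ i ∈ S, r i))]
    _ ≤ 2 * (S.card * M * ∑ i ∈ S, |r i|) + S.card * ∑ i ∈ S, r i ^ 2 := by gcongr
    _ = (2 * M * ∑ i ∈ S, |r i| + ∑ i ∈ S, r i ^ 2) * S.card := by ring
    _ ≤ _ := mul_le_mul_of_nonneg_left (by linarith) (by positivity)

theorem abs_ridge_sub_ridge_le_of_subset {b M : ℝ} (hb : 0 < b) (hM : 0 ≤ M) {h : ℕ → ℝ}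
    (hh : ∀ i, |h i| ≤ M) {A C : Finset ℕ} (hCA : C ⊆ A) :
    |ridge b h A - ridge b h C| ≤ 3 * M ^ 2 * (A \ C).card := by
  have hsum : ∑ i ∈ A, h i = ∑ i ∈ A \ C, h i + ∑ i ∈ C, h i :=
    (Finset.sum_sdiff hCA).symm
  have hcard : (A.card : ℝ) = (A \ C).card + C.card := by
    exact_mod_cast (Finset.card_sdiff_add_card_eq_card hCA).symm
  have hD := abs_sum_le_card_mul hh (A \ C)
  have hC := abs_sum_le_card_mul hh C
  rw [ridge, ridge, hsum, hcard]
  set D := ∑ i ∈ A \ C, h i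
  set T := ∑ i ∈ C, h i
  have hd0 : (0 : ℝ) ≤ (A \ C).card := by positivity
  have hN0 : (0 : ℝ) ≤ C.card := by positivity
  generalize ((A \ C).card : ℝ) = d at *
  generalize (C.card : ℝ) = N at *
  have e1 : 0 < b + N := by positivity
  have e2 : 0 < b + (d + N) := by positivity
  have hT2 : T ^ 2 ≤ (N * M) ^ 2 := by
    rw [← sq_abs T]
    gcongr
  -- The change of numerator, worth at most `2 M² d`, is separated from the change of denominator,
  -- worth at most `M² d`.
  have hkey : (D + T) ^ 2 / (b + (d + N)) - T ^ 2 / (b + N)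
      = D * (D + 2 * T) / (b + (d + N)) - T ^ 2 * d / ((b + N) * (b + (d + N))) := by
    field_simp
    ring
  have h1 : |D * (D + 2 * T) / (b + (d + N))| ≤ 2 * M ^ 2 * d := by
    rw [abs_div, abs_of_pos e2, div_le_iff₀ e2, abs_mul]
    have : |D + 2 * T| ≤ d * M + 2 * (N * M) := by
      refine (abs_add_le _ _).trans ?_
      rw [abs_mul, abs_two]
      gcongr
    calc |D| * |D + 2 * T| ≤ (d * M) * (d * M + 2 * (N * M)) := by gcongr
      _ = M ^ 2 * d * (d + 2 * N) := by ring
      _ ≤ M ^ 2 * d * (2 * (b + (d + N))) := by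
          refine mul_le_mul_of_nonneg_left (by linarith) (by positivity)
      _ = _ := by ring
  have h2 : |T ^ 2 * d / ((b + N) * (b + (d + N)))| ≤ M ^ 2 * d := by
    rw [abs_of_nonneg (by positivity), div_le_iff₀ (by positivity)]
    calc T ^ 2 * d ≤ (N * M) ^ 2 * d := by gcongr
      _ = M ^ 2 * d * (N * N) := by ring
      _ ≤ M ^ 2 * d * ((b + N) * (b + (d + N))) := by
          refine mul_le_mul_of_nonneg_left ?_ (by positivity)
          exact mul_le_mul (by linarith) (by linarith) hN0 e1.le
  rw [hkey]
  refine (abs_sub _ _).trans ?_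
  linarith

/-- Both sets are truncated, then compared through `A ∩ B`; each of the two comparisons costs `3 M²`
per removed observation. -/
theorem abs_ridge_sub_ridge_le {b M : ℝ} (hb : 0 < b) (hM : 0 ≤ M) (ys : ℕ → ℝ)
    {A B R D : Finset ℕ} (hA : A ⊆ R) (hB : B ⊆ R) (hAB : A \ B ⊆ D) (hBA : B \ A ⊆ D) :
    |ridge b ys A - ridge b ys B|
      ≤ 2 * ∑ i ∈ R, max (ys i ^ 2 - M ^ 2) 0 + 6 * M ^ 2 * D.card := by
  have hle : ∀ S ⊆ R, ∑ i ∈ S, max (ys i ^ 2 - M ^ 2) 0 ≤ ∑ i ∈ R, max (ys i ^ 2 - M ^ 2) 0 :=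
    fun S hS => Finset.sum_le_sum_of_subset_of_nonneg hS fun i _ _ => le_max_right _ _
  have tA := (abs_ridge_sub_ridge_trunc_le hb hM ys A).trans (hle A hA)
  have tB := (abs_ridge_sub_ridge_trunc_le hb hM ys B).trans (hle B hB)
  have lA := abs_ridge_sub_ridge_le_of_subset hb hM (fun i => abs_trunc_le hM (ys i))
    (Finset.inter_subset_left : A ∩ B ⊆ A)
  have lB := abs_ridge_sub_ridge_le_of_subset hb hM (fun i => abs_trunc_le hM (ys i))
    (Finset.inter_subset_right : A ∩ B ⊆ B)
  rw [Finset.sdiff_inter_self_left] at lA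
  rw [Finset.sdiff_inter_self_right] at lB
  have cA : ((A \ B).card : ℝ) ≤ D.card := by exact_mod_cast Finset.card_le_card hAB
  have cB : ((B \ A).card : ℝ) ≤ D.card := by exact_mod_cast Finset.card_le_card hBA
  have lA' := lA.trans (mul_le_mul_of_nonneg_left cA (by positivity : 0 ≤ 3 * M ^ 2))
  have lB' := lB.trans (mul_le_mul_of_nonneg_left cB (by positivity : 0 ≤ 3 * M ^ 2))
  rw [abs_le] at *
  constructor <;> linarith [tA.1, tA.2, tB.1, tB.2, lA'.1, lA'.2, lB'.1, lB'.2]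

/-! ### Observations separated by nearby cuts -/

open Classical in
/-- The observations, among the first `n`, that are sent to different sides by `c` and `c'`. -/
def splitObs {p : ℕ} (xs : ℕ → Fin p → ℝ) (n : ℕ) (c c' : Cut p) : Finset ℕ :=
  {i ∈ Finset.range n | ¬ (GoesLeft c (xs i) ↔ GoesLeft c' (xs i))}

open Classical in
/-- The observations, among the first `n`, whose `j`-th coordinate lies in `[q/m, (q+1)/m)`. -/
def cellObs {p : ℕ} (xs : ℕ → Fin p → ℝ) (n m : ℕ) (j : Fin p) (q : ℕ) : Finset ℕ :=
  {i ∈ Finset.range n | ⌊(m : ℝ) * xs i j⌋ = q}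

theorem mem_node_iff_of_samePath {p k : ℕ} {x z : Fin p → ℝ} {c c' : Fin (k + 1) → Cut p}
    (hp : SamePath x c c') (hz : ∀ l, (GoesLeft (c l) z ↔ GoesLeft (c' l) z)) :
    z ∈ node x (Fin.init c) ↔ z ∈ node x (Fin.init c') := by
  simp only [node, Set.mem_ofPred_eq]
  refine and_congr_right fun _ => forall_congr' fun l => ?_
  rw [hp l]
  exact iff_congr (hz l.castSucc) Iff.rfl

theorem leftObs_subset_range {p k : ℕ} (xs : ℕ → Fin p → ℝ) (n : ℕ) (x : Fin p → ℝ)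
    (c : Fin (k + 1) → Cut p) : leftObs xs n x c ⊆ Finset.range n := by
  classical
  exact Finset.filter_subset _ _

theorem rightObs_subset_range {p k : ℕ} (xs : ℕ → Fin p → ℝ) (n : ℕ) (x : Fin p → ℝ)
    (c : Fin (k + 1) → Cut p) : rightObs xs n x c ⊆ Finset.range n := by
  classical
  exact Finset.filter_subset _ _

theorem leftObs_sdiff_subset {p k : ℕ} (xs : ℕ → Fin p → ℝ) (n : ℕ) {x : Fin p → ℝ}
    {c c' : Fin (k + 1) → Cut p} (hp : SamePath x c c') :
    leftObs xs n x c \ leftObs xs n x c'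
      ⊆ Finset.univ.biUnion fun l => splitObs xs n (c l) (c' l) := by
  intro i hi
  by_contra hcon
  simp only [Finset.mem_biUnion, Finset.mem_univ, true_and, splitObs, Finset.mem_filter,
    not_exists, not_and, not_not] at hcon
  simp only [leftObs, Finset.mem_sdiff, Finset.mem_filter] at hi
  obtain ⟨⟨hn, h1, h2⟩, h3⟩ := hi
  exact h3 ⟨hn, (mem_node_iff_of_samePath hp fun l => hcon l hn).1 h1, (hcon _ hn).1 h2⟩

theorem rightObs_sdiff_subset {p k : ℕ} (xs : ℕ → Fin p → ℝ) (n : ℕ) {x : Fin p → ℝ}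
    {c c' : Fin (k + 1) → Cut p} (hp : SamePath x c c') :
    rightObs xs n x c \ rightObs xs n x c'
      ⊆ Finset.univ.biUnion fun l => splitObs xs n (c l) (c' l) := by
  intro i hi
  by_contra hcon
  simp only [Finset.mem_biUnion, Finset.mem_univ, true_and, splitObs, Finset.mem_filter,
    not_exists, not_and, not_not] at hcon
  simp only [rightObs, Finset.mem_sdiff, Finset.mem_filter] at hi
  obtain ⟨⟨hn, h1, h2⟩, h3⟩ := hi
  exact h3 ⟨hn, (mem_node_iff_of_samePath hp fun l => hcon l hn).1 h1,
    fun h => h2 ((hcon _ hn).2 h)⟩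

theorem SamePath.symm {p k : ℕ} {x : Fin p → ℝ} {c c' : Fin (k + 1) → Cut p}
    (h : SamePath x c c') : SamePath x c' c := fun l => (h l).symm

theorem splitObs_comm {p : ℕ} (xs : ℕ → Fin p → ℝ) (n : ℕ) (c c' : Cut p) :
    splitObs xs n c c' = splitObs xs n c' c := by
  ext i
  simp only [splitObs, Finset.mem_filter, iff_comm]

/-- A separated observation has its coordinate in `(s, t]`. Scaling by `m` places it in `[m s, m s +
1]`, where the floor takes only two values. -/
theorem splitObs_subset_of_le {p : ℕ} (xs : ℕ → Fin p → ℝ) (n : ℕ) {m : ℕ} (hm : 0 < m)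
    {j : Fin p} {s t : ℝ} (hs : 0 ≤ s) (hst : s ≤ t) (hts : t - s ≤ 1 / m) :
    splitObs xs n (j, s) (j, t)
      ⊆ cellObs xs n m j ⌊(m : ℝ) * s⌋₊ ∪ cellObs xs n m j (⌊(m : ℝ) * s⌋₊ + 1) := by
  intro i hi
  classical
  obtain ⟨hn, h⟩ := Finset.mem_filter.1 hi
  simp only [GoesLeft] at h
  have hm' : (0 : ℝ) < m := by exact_mod_cast hm
  have h1 : s < xs i j := by
    by_contra hc
    exact h ⟨fun _ => (not_lt.1 hc).trans hst, fun _ => not_lt.1 hc⟩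
  have h2 : xs i j ≤ t := by
    by_contra hc
    exact h ⟨fun h' => absurd h1 (not_lt.2 h'), fun h' => absurd h' hc⟩
  have h3 : (m : ℝ) * s ≤ m * xs i j := by gcongr
  have h4 : (m : ℝ) * xs i j ≤ m * s + 1 := by
    have : xs i j ≤ s + 1 / m := by linarith
    calc (m : ℝ) * xs i j ≤ m * (s + 1 / m) := by gcongr
      _ = m * s + 1 := by field_simp
  have hq : ((⌊(m : ℝ) * s⌋₊ : ℕ) : ℤ) = ⌊(m : ℝ) * s⌋ :=
    Int.natCast_floor_eq_floor (by positivity)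
  have h5 : ⌊(m : ℝ) * s⌋ ≤ ⌊(m : ℝ) * xs i j⌋ := Int.floor_le_floor h3
  have h6 : ⌊(m : ℝ) * xs i j⌋ ≤ ⌊(m : ℝ) * s⌋ + 1 := by
    rw [← Int.floor_add_one]
    exact Int.floor_le_floor h4
  simp only [cellObs, Finset.mem_union, Finset.mem_filter, hn, true_and]
  push_cast
  omega

theorem card_splitObs_le {p : ℕ} (xs : ℕ → Fin p → ℝ) (n : ℕ) {m : ℕ} (hm : 0 < m)
    {K : ℝ} (hK : ∀ j, ∀ q ≤ m + 1, ((cellObs xs n m j q).card : ℝ) ≤ K)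
    {c c' : Cut p} (hcc : c.1 = c'.1) (hc : c.2 ∈ Set.Icc (0 : ℝ) 1)
    (hc' : c'.2 ∈ Set.Icc (0 : ℝ) 1) (hd : |c.2 - c'.2| ≤ 1 / m) :
    ((splitObs xs n c c').card : ℝ) ≤ 2 * K := by
  obtain ⟨j, s⟩ := c
  obtain ⟨j', t⟩ := c'
  obtain rfl : j = j' := hcc
  simp only at hc hc' hd
  wlog hst : s ≤ t generalizing s t
  · rw [splitObs_comm]
    exact this t hc' s hc (by rwa [abs_sub_comm]) (le_of_not_ge hst)
  -- The value `s = 1` is allowed, so the second slab may have index `m + 1`.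
  have hq : ⌊(m : ℝ) * s⌋₊ ≤ m := by
    refine (Nat.floor_le_floor (mul_le_of_le_one_right (by positivity) hc.2)).trans ?_
    simp
  have hsub := splitObs_subset_of_le xs n hm (j := j) hc.1 hst
    (by rw [abs_sub_comm] at hd; exact (le_abs_self _).trans hd)
  have h1 := (Finset.card_le_card hsub).trans (Finset.card_union_le _ _)
  have h2 := hK j _ (hq.trans (Nat.le_succ m))
  have h3 := hK j _ (Nat.succ_le_succ hq)
  have h1' : ((splitObs xs n (j, s) (j, t)).card : ℝ)
      ≤ (cellObs xs n m j ⌊(m : ℝ) * s⌋₊).card + (cellObs xs n m j (⌊(m : ℝ) * s⌋₊ + 1)).card := by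
    exact_mod_cast h1
  simp only [Nat.succ_eq_add_one] at h3
  linarith

theorem cut_close_of_cutDist_le {p k : ℕ} {c c' : Fin k → Cut p} {δ : ℝ} (hδ : δ < 1)
    (h : cutDist c c' ≤ δ) (l : Fin k) : (c l).1 = (c' l).1 ∧ |(c l).2 - (c' l).2| ≤ δ := by
  have hl := (le_ciSup (f := fun l : Fin k =>
    max |(((c l).1 : ℕ) : ℝ) - (((c' l).1 : ℕ) : ℝ)| |(c l).2 - (c' l).2|)
    (Set.finite_range _).bddAbove l).trans h
  obtain ⟨h1, h2⟩ := max_le_iff.1 hl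
  refine ⟨?_, h2⟩
  -- Variable indices are integers, so a difference below `1` vanishes.
  have h3 : |((((c l).1 : ℕ) : ℤ) - (((c' l).1 : ℕ) : ℤ) : ℤ)| < 1 := by
    have := h1.trans_lt hδ
    exact_mod_cast this
  rw [Int.abs_lt_one_iff] at h3
  exact Fin.ext (by omega)

/-! ### Deterministic bound on the modulus -/

/-- A code with counts at most `n`, as an element of a finite type. -/
def codeOfFin {p k n : ℕ} (a : Fin k → Fin p × Fin (n + 1) × Prop) : Fin k → CutCode p :=
  fun l => ((a l).1, ((a l).2.1 : ℕ), (a l).2.2)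

theorem exists_codeOfFin_eq_cutCode {p k : ℕ} (xs : ℕ → Fin p → ℝ) (n : ℕ) (x : Fin p → ℝ)
    (c : Fin k → Cut p) :
    ∃ a : Fin k → Fin p × Fin (n + 1) × Prop, codeOfFin a = cutCode xs n x c := by
  classical
  refine ⟨fun l => ((c l).1, ⟨(Finset.card {i ∈ Finset.range n | GoesLeft (c l) (xs i)}), ?_⟩,
    GoesLeft (c l) x), ?_⟩
  · have := Finset.card_filter_le (Finset.range n) (fun i => GoesLeft (c l) (xs i))
    rw [Finset.card_range] at this
    omega
  · funext l
    simp only [codeOfFin, cutCode]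

/-- The sample is fixed here. The bounds `hK`, `hT` and `hG` do not involve the cuts, so the
estimate is uniform over all pairs; each fails with probability tending to `0` for suitable
constants. -/
theorem criterionModulus_le {p k : ℕ} {σ τ : ℝ} (hσ : 0 < σ) (hτ : 0 < τ)
    (xs : ℕ → Fin p → ℝ) (ys : ℕ → ℝ) (g : (Fin (k + 1) → CutCode p) → ℝ) {n m : ℕ}
    (hn : 0 < n) (hm : 1 < m) (x : Fin p → ℝ) (ξ : ℝ) {M K T G : ℝ} (hM : 0 ≤ M)
    (hK : ∀ j, ∀ q ≤ m + 1, ((cellObs xs n m j q).card : ℝ) ≤ K * n)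
    (hT : ∑ i ∈ Finset.range n, max (ys i ^ 2 - M ^ 2) 0 ≤ T * n)
    (hG : ∀ a : Fin (k + 1) → Fin p × Fin (n + 1) × Prop, |g (codeOfFin a)| ≤ G * n) :
    criterionModulus ξ x (1 / m) (splitCriterion σ τ xs ys g n x)
      ≤ ENNReal.ofReal
          ((4 * T + 24 * M ^ 2 * ((k + 1) * K)) / σ ^ 2 + 2 * G) := by
  have hn' : (0 : ℝ) < n := by exact_mod_cast hn
  have hm1 : (1 : ℝ) / m < 1 := by
    rw [div_lt_one (by positivity)]
    exact_mod_cast hm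
  refine iSup₂_le fun c hc => iSup₂_le fun c' hc' => iSup₂_le fun hd hp =>
    ENNReal.ofReal_le_ofReal ?_
  have hclose := cut_close_of_cutDist_le hm1 hd
  set D := Finset.univ.biUnion fun l => splitObs xs n (c l) (c' l) with hDdef
  have hD' : (Finset.univ.biUnion fun l => splitObs xs n (c' l) (c l)) = D := by
    simp only [hDdef, splitObs_comm]
  have hDcard : (D.card : ℝ) ≤ (k + 1) * (2 * (K * n)) := by
    have h1 : (D.card : ℝ) ≤ ∑ l, ((splitObs xs n (c l) (c' l)).card : ℝ) := by
      exact_mod_cast Finset.card_biUnion_le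
    refine h1.trans ?_
    have h2 := Finset.sum_le_card_nsmul Finset.univ
      (fun l => ((splitObs xs n (c l) (c' l)).card : ℝ)) (2 * (K * n)) fun l _ =>
        card_splitObs_le xs n (by omega) hK (hclose l).1 (hc.1 l) (hc'.1 l) (hclose l).2
    simpa using h2
  have key : ∀ A B : Finset ℕ, A ⊆ Finset.range n → B ⊆ Finset.range n → A \ B ⊆ D →
      B \ A ⊆ D → |childTerm σ τ ys n A - childTerm σ τ ys n B|
        ≤ (2 * T + 12 * M ^ 2 * ((k + 1) * K)) / σ ^ 2 := by
    intro A B hA hB hAB hBA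
    rw [childTerm_eq_ridge hσ hτ, childTerm_eq_ridge hσ hτ, ← sub_div, abs_div,
      abs_of_pos (by positivity : 0 < σ ^ 2 * n), div_le_div_iff₀ (by positivity) (by positivity)]
    have h := abs_ridge_sub_ridge_le (div_pos (sq_pos_of_pos hσ) hτ) hM ys hA hB hAB hBA
    have h' : |ridge (σ ^ 2 / τ) ys A - ridge (σ ^ 2 / τ) ys B|
        ≤ (2 * T + 12 * M ^ 2 * ((k + 1) * K)) * n := by
      have : 6 * M ^ 2 * (D.card : ℝ) ≤ 6 * M ^ 2 * ((k + 1) * (2 * (K * n))) := by gcongr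
      linarith
    calc _ ≤ (2 * T + 12 * M ^ 2 * ((k + 1) * K)) * n * σ ^ 2 := by gcongr
      _ = _ := by ring
  have hL := key (leftObs xs n x c) (leftObs xs n x c') (leftObs_subset_range ..)
    (leftObs_subset_range ..) (leftObs_sdiff_subset xs n hp)
    (hD' ▸ leftObs_sdiff_subset xs n hp.symm)
  have hR := key (rightObs xs n x c) (rightObs xs n x c') (rightObs_subset_range ..)
    (rightObs_subset_range ..) (rightObs_sdiff_subset xs n hp)
    (hD' ▸ rightObs_sdiff_subset xs n hp.symm)
  have hgn : ∀ c : Fin (k + 1) → Cut p, |g (cutCode xs n x c) / n| ≤ G := by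
    intro c
    obtain ⟨a, ha⟩ := exists_codeOfFin_eq_cutCode xs n x c
    rw [← ha, abs_div, abs_of_pos hn', div_le_iff₀ hn']
    exact hG a
  have hsplit : (4 * T + 24 * M ^ 2 * ((k + 1) * K)) / σ ^ 2
      = 2 * ((2 * T + 12 * M ^ 2 * ((k + 1) * K)) / σ ^ 2) := by ring
  have g1 := hgn c
  have g2 := hgn c'
  rw [hsplit, splitCriterion, splitCriterion]
  rw [abs_le] at *
  constructor <;> linarith [hL.1, hL.2, hR.1, hR.2, g1.1, g1.2, g2.1, g2.2]

end XBART

end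

/-! ### Laws of large numbers and tail bounds -/

namespace XBART

theorem tendsto_measure_lt_sum {Ω : Type*} [MeasurableSpace Ω] {P : Measure Ω}
    [IsProbabilityMeasure P] {Z : ℕ → Ω → ℝ} (hint : Integrable (Z 0) P)
    (hindep : Pairwise fun i j => IndepFun (Z i) (Z j) P)
    (hident : ∀ i, IdentDistrib (Z i) (Z 0) P P) {K : ℝ} (hK : P[Z 0] < K) :
    Tendsto (fun n : ℕ => P {ω | K * n < ∑ i ∈ Finset.range n, Z i ω}) atTop (𝓝 0) := by
  have hmeas : ∀ n : ℕ,
      AEStronglyMeasurable (fun ω => (∑ i ∈ Finset.range n, Z i ω) / (n : ℝ)) P := fun n =>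
    ((Finset.aemeasurable_fun_sum _ fun i _ =>
      (hident i).aemeasurable_fst).div_const _).aestronglyMeasurable
  have h := tendstoInMeasure_of_tendsto_ae hmeas
    (strong_law_ae_real Z hint hindep hident) (ENNReal.ofReal (K - P[Z 0]))
    (ENNReal.ofReal_pos.2 (sub_pos.2 hK))
  refine tendsto_of_tendsto_of_tendsto_of_le_of_le' tendsto_const_nhds h
    (Eventually.of_forall fun _ => zero_le) ?_
  filter_upwards [eventually_gt_atTop 0] with n hn
  refine measure_mono fun ω hω => ?_
  have hn' : (0 : ℝ) < n := by exact_mod_cast hn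
  have hω' : K < (∑ i ∈ Finset.range n, Z i ω) / (n : ℝ) := (lt_div_iff₀ hn').2 hω
  change ENNReal.ofReal _ ≤ edist _ _
  rw [edist_dist, Real.dist_eq]
  exact ENNReal.ofReal_le_ofReal ((sub_le_sub_right hω'.le _).trans (le_abs_self _))

theorem gumbel_density_le (t : ℝ) : Real.exp (-(t + Real.exp (-t))) ≤ Real.exp (-|t|) := by
  rw [Real.exp_le_exp]
  rcases le_total 0 t with h | h
  · rw [abs_of_nonneg h]
    linarith [Real.exp_pos (-t)]
  · rw [abs_of_nonpos h]
    -- With `u = -t`, the claim is `2 u ≤ exp u`, which follows from `1 + u + u² / 2 ≥ 2 u`.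
    have := Real.quadratic_le_exp_of_nonneg (neg_nonneg.2 h)
    nlinarith [sq_nonneg (t + 1)]

theorem gumbelMeasure_tail_le {s : ℝ} (hs : 0 ≤ s) :
    gumbelMeasure {t | s < |t|} ≤ ENNReal.ofReal (2 * Real.exp (-s)) := by
  have hset : {t : ℝ | s < |t|} ⊆ Set.Ioi s ∪ Set.Iic (-s) := by
    intro t ht
    rcases lt_abs.1 (show s < |t| from ht) with h | h
    · exact Or.inl h
    · exact Or.inr (by simp only [Set.mem_Iic]; linarith)
  have hpos : gumbelMeasure (Set.Ioi s) ≤ ENNReal.ofReal (Real.exp (-s)) := by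
    rw [gumbelMeasure, withDensity_apply _ measurableSet_Ioi, ← integral_exp_neg_Ioi,
      ofReal_integral_eq_lintegral_ofReal (integrableOn_exp_neg_Ioi s)
        (ae_of_all _ fun t => (Real.exp_pos _).le)]
    refine setLIntegral_mono' measurableSet_Ioi fun t ht => ENNReal.ofReal_le_ofReal ?_
    simpa [abs_of_nonneg (hs.trans (le_of_lt ht))] using gumbel_density_le t
  have hneg : gumbelMeasure (Set.Iic (-s)) ≤ ENNReal.ofReal (Real.exp (-s)) := by
    rw [gumbelMeasure, withDensity_apply _ measurableSet_Iic, ← integral_exp_Iic,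
      ofReal_integral_eq_lintegral_ofReal (integrableOn_exp_Iic (-s))
        (ae_of_all _ fun t => (Real.exp_pos _).le)]
    refine setLIntegral_mono' measurableSet_Iic fun t ht => ENNReal.ofReal_le_ofReal ?_
    have h0 : t ≤ 0 := by
      have : t ≤ -s := ht
      linarith
    simpa [abs_of_nonpos h0] using gumbel_density_le t
  calc gumbelMeasure {t | s < |t|} ≤ gumbelMeasure (Set.Ioi s ∪ Set.Iic (-s)) := measure_mono hset
    _ ≤ gumbelMeasure (Set.Ioi s) + gumbelMeasure (Set.Iic (-s)) := measure_union_le _ _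
    _ ≤ ENNReal.ofReal (Real.exp (-s)) + ENNReal.ofReal (Real.exp (-s)) := add_le_add hpos hneg
    _ = _ := by rw [← ENNReal.ofReal_add (Real.exp_pos _).le (Real.exp_pos _).le, two_mul]

theorem tendsto_card_codes_mul_exp (p k : ℕ) {G : ℝ} (hG : 0 < G) :
    Tendsto (fun n : ℕ => ((p * ((n + 1) * 2) : ℕ) : ℝ) ^ k * (2 * Real.exp (-(G * n))))
      atTop (𝓝 0) := by
  have h := (tendsto_pow_const_mul_const_pow_of_lt_one k (Real.exp_pos (-G)).le
    (Real.exp_lt_one_iff.2 (by linarith))).comp (tendsto_add_atTop_nat 1)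
  have h2 := h.const_mul ((p * 2 : ℝ) ^ k * 2 * Real.exp G)
  rw [mul_zero] at h2
  refine h2.congr fun n => ?_
  have he : Real.exp (-(G * n)) = Real.exp G * Real.exp (-G) ^ (n + 1) := by
    rw [← Real.exp_nat_mul, ← Real.exp_add]
    congr 1
    push_cast
    ring
  rw [he]
  simp only [Function.comp_apply]
  push_cast
  rw [show (p : ℝ) * ((n + 1) * 2) = p * 2 * (n + 1) by ring, mul_pow _ ((n : ℝ) + 1)]
  ring

/-- A union bound uses only the marginal laws, so any dependence is allowed. -/
theorem tendsto_measure_gumbel {Ω : Type*} [MeasurableSpace Ω] {P : Measure Ω} {p k : ℕ}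
    {γ : ℕ → (Fin k → CutCode p) → Ω → ℝ} (hγ : ∀ n a, HasLaw (γ n a) gumbelMeasure P)
    {G : ℝ} (hG : 0 < G) :
    Tendsto (fun n : ℕ => P (⋃ a : Fin k → Fin p × Fin (n + 1) × Prop,
      {ω | G * n < |γ n (codeOfFin a) ω|})) atTop (𝓝 0) := by
  have h := ENNReal.tendsto_ofReal (tendsto_card_codes_mul_exp p k hG)
  rw [ENNReal.ofReal_zero] at h
  refine tendsto_of_tendsto_of_tendsto_of_le_of_le tendsto_const_nhds h
    (fun _ => zero_le) fun n => ?_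
  have htail : ∀ a : Fin k → Fin p × Fin (n + 1) × Prop,
      P {ω | G * n < |γ n (codeOfFin a) ω|} ≤ ENNReal.ofReal (2 * Real.exp (-(G * n))) := by
    intro a
    have hset : MeasurableSet {t : ℝ | G * n < |t|} :=
      measurableSet_lt measurable_const measurable_norm
    refine le_trans (le_of_eq ?_) (gumbelMeasure_tail_le (by positivity))
    exact (hγ n (codeOfFin a)).measure_eq hset
  calc _ ≤ ∑ a : Fin k → Fin p × Fin (n + 1) × Prop, P {ω | G * n < |γ n (codeOfFin a) ω|} :=
        measure_iUnion_fintype_le _ _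
    _ ≤ ∑ _a : Fin k → Fin p × Fin (n + 1) × Prop, ENNReal.ofReal (2 * Real.exp (-(G * n))) :=
        Finset.sum_le_sum fun a _ => htail a
    _ = _ := by
        rw [Finset.sum_const, nsmul_eq_mul, Finset.card_univ, ← Nat.cast_pow,
          ENNReal.ofReal_mul (Nat.cast_nonneg _), ENNReal.ofReal_natCast]
        congr 2
        simp

theorem volume_cell_le {p m : ℕ} (hm : 0 < m) (j : Fin p) (q : ℕ) :
    volume.restrict (Set.Icc (0 : Fin p → ℝ) 1) {z | ⌊(m : ℝ) * z j⌋ = q}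
      ≤ ENNReal.ofReal (1 / m) := by
  have hm' : (0 : ℝ) < m := by exact_mod_cast hm
  rw [Measure.restrict_apply' measurableSet_Icc]
  have hsub : {z : Fin p → ℝ | ⌊(m : ℝ) * z j⌋ = q} ∩ Set.Icc 0 1
      ⊆ Set.Icc (Function.update 0 j ((q : ℝ) / m)) (Function.update 1 j (((q : ℝ) + 1) / m)) := by
    rintro z ⟨hz, h0, h1⟩
    have hz' : ⌊(m : ℝ) * z j⌋ = (q : ℤ) := hz
    rw [Int.floor_eq_iff] at hz'
    push_cast at hz'
    constructor
    · rw [update_le_iff]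
      refine ⟨?_, fun i _ => h0 i⟩
      rw [div_le_iff₀ hm']
      linarith [hz'.1]
    · rw [le_update_iff]
      refine ⟨?_, fun i _ => h1 i⟩
      rw [le_div_iff₀ hm']
      linarith [hz'.2]
  refine (measure_mono hsub).trans (le_of_eq ?_)
  rw [Real.volume_Icc_pi, Finset.prod_eq_single j]
  · simp only [Function.update_self]
    congr 1
    ring
  · intro i _ hij
    simp [Function.update_of_ne hij]
  · simp

theorem tendsto_measure_cellObs {Ω : Type*} [MeasurableSpace Ω] {P : Measure Ω}
    [IsProbabilityMeasure P] {p : ℕ} {X : ℕ → Ω → Fin p → ℝ} (hX : ∀ i, Measurable (X i))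
    (hindep : Pairwise fun i j => IndepFun (X i) (X j) P)
    (hident : ∀ i, IdentDistrib (X i) (X 0) P P)
    (hunif : HasLaw (X 0) (volume.restrict (Set.Icc (0 : Fin p → ℝ) 1)) P)
    {m : ℕ} (hm : 0 < m) (j : Fin p) (q : ℕ) :
    Tendsto (fun n : ℕ => P {ω | 2 / (m : ℝ) * n < (cellObs (fun i => X i ω) n m j q).card})
      atTop (𝓝 0) := by
  have hm' : (0 : ℝ) < m := by exact_mod_cast hm
  set s : Set (Fin p → ℝ) := {z | ⌊(m : ℝ) * z j⌋ = q} with hs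
  have hsm : MeasurableSet s :=
    (Int.measurable_floor.comp (measurable_const.mul (measurable_pi_apply j)))
      (measurableSet_singleton (q : ℤ))
  set φ : (Fin p → ℝ) → ℝ := s.indicator 1 with hφ
  have hφm : Measurable φ := measurable_one.indicator hsm
  have hint : Integrable (fun ω => φ (X 0 ω)) P := by
    have : Integrable ((X 0 ⁻¹' s).indicator (1 : Ω → ℝ)) P :=
      (integrable_const (1 : ℝ)).indicator (hX 0 hsm)
    exact this
  have hE : P[fun ω => φ (X 0 ω)] < 2 / (m : ℝ) := by
    have h1 : P[fun ω => φ (X 0 ω)] = P.real (X 0 ⁻¹' s) :=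
      integral_indicator_one (hX 0 hsm)
    have h2 : P (X 0 ⁻¹' s) ≤ ENNReal.ofReal (1 / m) := by
      rw [← Measure.map_apply (hX 0) hsm, hunif.map_eq]
      exact volume_cell_le hm j q
    have h3 : P.real (X 0 ⁻¹' s) ≤ 1 / m := ENNReal.toReal_le_of_le_ofReal (by positivity) h2
    rw [h1]
    -- The factor `2` gives the strict gap above the mean that the law of large numbers needs.
    exact h3.trans_lt (by gcongr; norm_num)
  have h := tendsto_measure_lt_sum (Z := fun i ω => φ (X i ω)) hint
    (fun i l hil => (hindep hil).comp hφm hφm) (fun i => (hident i).comp hφm) hE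
  refine h.congr fun n => ?_
  congr! 4 with ω
  classical
  rw [cellObs, Finset.card_filter, Nat.cast_sum]
  refine Finset.sum_congr rfl fun i _ => ?_
  simp only [hφ, hs, Set.indicator_apply, Set.mem_ofPred_eq, Pi.one_apply]
  push_cast
  rfl

/-- Dominated convergence with bound `Y²`: at each point the integrand is eventually `0`. -/
theorem exists_integral_truncation_lt {Ω : Type*} [MeasurableSpace Ω] {P : Measure Ω}
    {Y : Ω → ℝ} (hYm : Measurable Y) (hY : MemLp Y 2 P) {ε : ℝ} (hε : 0 < ε) :
    ∃ M : ℕ, ∫ ω, max (Y ω ^ 2 - (M : ℝ) ^ 2) 0 ∂P < ε := by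
  have h : Tendsto (fun M : ℕ => ∫ ω, max (Y ω ^ 2 - (M : ℝ) ^ 2) 0 ∂P) atTop
      (𝓝 (∫ _, (0 : ℝ) ∂P)) := by
    refine tendsto_integral_of_dominated_convergence (fun ω => Y ω ^ 2)
      (fun M => by fun_prop) hY.integrable_sq
      (fun M => ae_of_all _ fun ω => ?_) (ae_of_all _ fun ω => ?_)
    · rw [Real.norm_of_nonneg (le_max_right _ _)]
      exact max_le (by nlinarith [sq_nonneg (M : ℝ)]) (sq_nonneg _)
    · obtain ⟨N, hN⟩ := exists_nat_ge |Y ω|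
      refine tendsto_const_nhds.congr' ?_
      filter_upwards [eventually_ge_atTop N] with M hM
      have h1 : |Y ω| ≤ M := hN.trans (by exact_mod_cast hM)
      have h2 : Y ω ^ 2 ≤ (M : ℝ) ^ 2 := by
        rw [← sq_abs]
        gcongr
      rw [max_eq_right (by linarith)]
  rw [integral_zero] at h
  exact ((tendsto_order.1 h).2 ε hε).exists

end XBART

/-! ### Choice of constants and conclusion -/

theorem mainTheorem3 {Ω : Type*} [MeasurableSpace Ω] (P : Measure Ω) [IsProbabilityMeasure P]
    (p : ℕ) (f : (Fin p → ℝ) → ℝ)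
    (hf_cont : ContinuousOn f (Set.Icc 0 1))
    (hf_bdd : ∃ M : ℝ, ∀ z ∈ Set.Icc (0 : Fin p → ℝ) 1, |f z| ≤ M)
    -- the i.i.d. data
    (X : ℕ → Ω → Fin p → ℝ) (Y : ℕ → Ω → ℝ)
    (hX_meas : ∀ i, Measurable (X i)) (hY_meas : ∀ i, Measurable (Y i))
    (h_indep : iIndepFun (fun i ω => (X i ω, Y i ω)) P)
    (h_ident : ∀ i, IdentDistrib (fun ω => (X i ω, Y i ω)) (fun ω => (X 0 ω, Y 0 ω)) P P)
    (hX_unif : ∀ i, HasLaw (X i) (volume.restrict (Set.Icc (0 : Fin p → ℝ) 1)) P)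
    (hY_sq : ∀ i, MemLp (Y i) 2 P)
    (hY_reg : ∀ i, P[Y i | MeasurableSpace.comap (X i) inferInstance]
      =ᵐ[P] fun ω => f (X i ω))
    -- the model parameters
    (σ τ : ℝ) (hσ : 0 < σ) (hτ : 0 < τ)
    -- the point, the depth `k + 1` and the edge length
    (x : Fin p → ℝ) (hx : x ∈ Set.Icc (0 : Fin p → ℝ) 1) (k : ℕ) (ξ : ℝ) (hξ : 0 < ξ)
    -- the Gumbel perturbations of the candidate cutpoints, of any joint law
    (γ : ℕ → (Fin (k + 1) → XBART.CutCode p) → Ω → ℝ)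
    (hγ : ∀ n a, HasLaw (γ n a) XBART.gumbelMeasure P)
    (α ρ : ℝ) (hα : 0 < α) (hρ : 0 < ρ) :
    ∃ δ : ℝ, 0 < δ ∧ ∃ q : ℝ≥0∞, q ≤ ENNReal.ofReal ρ ∧
      Tendsto (fun n : ℕ => P {ω | ENNReal.ofReal α <
          XBART.criterionModulus ξ x δ
            (XBART.splitCriterion σ τ (fun i => X i ω) (fun i => Y i ω)
              (fun a => γ n a ω) n x)})
        atTop (𝓝 q) := by
  have hXind : Pairwise fun i j => IndepFun (X i) (X j) P := fun i j hij =>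
    (h_indep.indepFun hij).comp measurable_fst measurable_fst
  have hXid : ∀ i, IdentDistrib (X i) (X 0) P P := fun i => (h_ident i).comp measurable_fst
  obtain ⟨M, hM⟩ := XBART.exists_integral_truncation_lt (hY_meas 0) (hY_sq 0)
    (show 0 < α * σ ^ 2 / 16 by positivity)
  -- Budget: `4 T / σ²` and the slab term get `α / 4` each, and the perturbations get `2 G = α / 2`
  -- with `G = α / 4`. The `+ 2` below ensures `1 / m < 1`.
  set T : ℝ := α * σ ^ 2 / 16 with hTdef
  obtain ⟨m, hm⟩ := exists_nat_ge (24 * (M : ℝ) ^ 2 * ((k + 1) * 2) / (α * σ ^ 2 / 4) + 2)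
  have hm2 : (2 : ℝ) ≤ m := le_trans (le_add_of_nonneg_left (by positivity)) hm
  have hm1 : 1 < m := by exact_mod_cast (one_lt_two.trans_le hm2 : (1 : ℝ) < m)
  have hm0 : (0 : ℝ) < m := by linarith
  have hslab : 24 * (M : ℝ) ^ 2 * ((k + 1) * (2 / m)) ≤ α * σ ^ 2 / 4 := by
    have h1 : 24 * (M : ℝ) ^ 2 * ((k + 1) * 2) / (α * σ ^ 2 / 4) ≤ m := by linarith
    rw [div_le_iff₀ (by positivity)] at h1
    calc 24 * (M : ℝ) ^ 2 * ((k + 1) * (2 / m)) = 24 * (M : ℝ) ^ 2 * ((k + 1) * 2) / m := by ring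
      _ ≤ _ := by rw [div_le_iff₀ hm0]; linarith
  refine ⟨1 / m, by positivity, 0, zero_le, ?_⟩
  set ψ : (Fin p → ℝ) × ℝ → ℝ := fun z => max (z.2 ^ 2 - (M : ℝ) ^ 2) 0 with hψ
  have hψm : Measurable ψ := by fun_prop
  have hψint : Integrable (fun ω => ψ (X 0 ω, Y 0 ω)) P := by
    refine (hY_sq 0).integrable_sq.mono' (by fun_prop) (ae_of_all _ fun ω => ?_)
    rw [Real.norm_of_nonneg (le_max_right _ _)]
    exact max_le (by nlinarith [sq_nonneg (M : ℝ)]) (sq_nonneg _)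
  have hresp := XBART.tendsto_measure_lt_sum (Z := fun i ω => ψ (X i ω, Y i ω)) hψint
    (fun i j hij => (h_indep.indepFun hij).comp hψm hψm) (fun i => (h_ident i).comp hψm) hM
  have hcells := tendsto_finsetSum (Finset.univ ×ˢ Finset.range (m + 2))
    fun (jq : Fin p × ℕ) _ => XBART.tendsto_measure_cellObs hX_meas hXind hXid (hX_unif 0)
      (zero_lt_one.trans hm1) jq.1 jq.2
  have hgumbel := XBART.tendsto_measure_gumbel hγ (show 0 < α / 4 by positivity)
  have hall := (hresp.add hcells).add hgumbel
  rw [Finset.sum_const_zero, add_zero, add_zero] at hall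
  refine tendsto_of_tendsto_of_tendsto_of_le_of_le' tendsto_const_nhds hall
    (Eventually.of_forall fun _ => zero_le) ?_
  filter_upwards [eventually_gt_atTop 0] with n hn
  -- Monotonicity and subadditivity hold for outer measure, so the modulus event need not be
  -- measurable.
  refine le_trans (measure_mono ?_) ((measure_union_le _ _).trans (add_le_add
    ((measure_union_le _ _).trans (add_le_add le_rfl (measure_biUnion_finset_le _ _))) le_rfl))
  intro ω hω
  by_contra hcon
  simp only [Set.mem_union, Set.mem_iUnion, Set.mem_ofPred_eq, not_or, not_exists, not_lt,
    Finset.mem_product, Finset.mem_univ, Finset.mem_range, true_and] at hcon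
  obtain ⟨⟨h1, h2⟩, h3⟩ := hcon
  have hlt : ENNReal.ofReal α < _ := hω
  refine absurd hlt (not_lt.2 ?_)
  refine (XBART.criterionModulus_le hσ hτ (fun i => X i ω) (fun i => Y i ω) (fun a => γ n a ω) hn
    hm1 x ξ (Nat.cast_nonneg M) (fun j q hq => h2 (j, q) (by omega)) h1 h3).trans
    (ENNReal.ofReal_le_ofReal ?_)
  have : (4 * T + 24 * (M : ℝ) ^ 2 * ((k + 1) * (2 / m))) / σ ^ 2 ≤ α / 2 := by
    rw [div_le_iff₀ (by positivity)]
    linarith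
  linarith
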